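/- Let $G$ be a finite connected multigraph (loops and parallel edges allowed), with an orientation of its edges fixed, let $\partial_1:\mathbb{Z}^{E(G)}\to\mathbb{Z}^{V(G)}$ be its incidence matrix (the column of an edge is its head minus its tail, so the column of a loop is zero), and let $Z_1(G)=\ker\partial_1$. Let $\mathscr{A}=(G,\partial)$ be a unicyclization of $G$, that is, $\partial$ is an integer matrix with rows indexed by $E(G)$ such that $\ker\partial=0$, $\partial_1\partial=0$ and $\operatorname{rk}(\ker\partial_1/\operatorname{im}\partial)=1$. Let $\beta$ be an ordered basis of the free abelian group $Z_1(G)$, and for $z\in Z_1(G)$ define the winding number $$w_{\mathscr{A}}(z)=\det\bigl([z]_\beta,[\partial]_\beta\bigr)\in\mathbb{Z},$$ where $[z]_\beta$ is the coordinate column of $z$, and $[\partial]_\beta$ is the matrix of the coordinate columns of the columns of $\partial$, with respect to $\beta$. Let $\mathcal{U}(G)$ be the set of cycletrees of $G$, i.e. connected spanning subgraphs $Y$ of $G$ with exactly one cycle $C_Y$; for each $Y\in\mathcal{U}(G)$ let $z_Y\in Z_1(G)$ be the element corresponding to $C_Y$ with either of its two orientations (coefficients $\pm1$ on the edges of $C_Y$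 and $0$ on all other edges). Put $$\lambda_{\mathscr{A}}=\sum_{Y\in\mathcal{U}(G)}w_{\mathscr{A}}(z_Y)\cdot z_Y .$$ Then for every $C\in\ker\partial_1$, $$C\circ\lambda_{\mathscr{A}}=w_{\mathscr{A}}(C)\cdot k(G),$$ where $\circ$ is the standard inner product on $\mathbb{Z}^{E(G)}$ and $k(G)$ is the number of spanning trees of $G$. -/

import Mathlib

open scoped Graph

namespace Graph

universe u v

variable {α : Type u} {β : Type v}

/-! ### Connected graphs, cycles, spanning trees and cycletrees

Graphs are multigraphs: loops and parallel edges are allowed. -/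

/-- A graph is connected if it has a vertex and any two vertices are joined by a walk. -/
def IsConnected (G : Graph α β) : Prop :=
  V(G).Nonempty ∧ ∀ x ∈ V(G), ∀ y ∈ V(G), Relation.ReflTransGen G.Adj x y

/-- A graph `C` is a cycle if, for some `n`, it consists of `n + 1` distinct vertices
`x 0, …, x n` and `n + 1` distinct edges `e 0, …, e n`, where `e i` joins `x i` to `x (i + 1)`,
with indices modulo `n + 1`. A loop is a cycle with one edge, and a pair of parallel edges is a
cycle with two edges. -/
def IsCycle (C : Graph α β) : Prop :=
  ∃ (n : ℕ) (x : Fin (n + 1) → α) (e : Fin (n + 1) → β),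
    Function.Injective x ∧ Function.Injective e ∧
    V(C) = Set.range x ∧ E(C) = Set.range e ∧
    ∀ i, C.IsLink (e i) (x i) (x (i + 1))

/-- `T` is a spanning tree of `G`: a connected spanning subgraph without cycles. -/
structure IsSpanningTree (G T : Graph α β) : Prop where
  spanning : T ≤s G
  connected : T.IsConnected
  acyclic : ∀ C : Graph α β, C ≤ T → ¬ C.IsCycle

/-- The tree-number `k(G)`: the number of spanning trees of `G`. -/
noncomputable def treeNumber (G : Graph α β) : ℕ :=
  Nat.card {T : Graph α β // G.IsSpanningTree T}

/-- `Y` is a cycletree in `G`: a connected spanning subgraph with exactly one cycle. -/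
structure IsCycletree (G Y : Graph α β) : Prop where
  spanning : Y ≤s G
  connected : Y.IsConnected
  existsUnique_cycle : ∃! C : Graph α β, C ≤ Y ∧ C.IsCycle

/-- The type of all cycletrees in `G`. -/
def Cycletree (G : Graph α β) : Type (max u v) :=
  {Y : Graph α β // G.IsCycletree Y}

/-- The unique cycle `C_Y` in a cycletree `Y`. -/
noncomputable def Cycletree.cycle {G : Graph α β} (Y : G.Cycletree) : Graph α β :=
  Y.2.existsUnique_cycle.choose

/-- A graph with finitely many edges has finitely many spanning subgraphs. -/
lemma finite_spanningSubgraphs (G : Graph α β) [Finite E(G)] :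
    {H : Graph α β | H ≤s G}.Finite := by
  have hE : E(G).Finite := Set.toFinite _
  refine Set.Finite.of_finite_image (f := fun H : Graph α β => E(H))
    (hE.finite_subsets.subset ?_) ?_
  · rintro _ ⟨H, hH, rfl⟩
    exact hH.le.edgeSet_mono
  · intro H hH K hK h
    have h' : E(H) = E(K) := h
    refine Graph.ext (hH.vertexSet_eq.trans hK.vertexSet_eq.symm) fun e x y => ?_
    constructor
    · intro he
      exact (hK.le.isLink_iff (h' ▸ he.edge_mem)).2 (he.mono hH.le)
    · intro he
      exact (hH.le.isLink_iff (h' ▸ he.edge_mem)).2 (he.mono hK.le)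

instance (G : Graph α β) [Finite E(G)] : Finite G.Cycletree :=
  (G.finite_spanningSubgraphs.subset fun _ h => IsCycletree.spanning h).to_subtype

/-! ### The incidence matrix and the cycle space -/

/-- An orientation of all the edges of `G` (for a loop, tail and head coincide). -/
structure Orientation (G : Graph α β) where
  tail : E(G) → V(G)
  head : E(G) → V(G)
  isLink : ∀ e : E(G), G.IsLink e (tail e) (head e)

namespace Orientation

variable {G : Graph α β}

open Classical in
/-- The incidence matrix `∂₁` of the oriented graph: the column of an edge is its head minus its
tail, so the column of a loop is zero. -/
noncomputable def incidenceMatrix (D : G.Orientation) : Matrix V(G) E(G) ℤ :=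
  Matrix.of fun x e => (if x = D.head e then 1 else 0) - (if x = D.tail e then 1 else 0)

variable [Fintype E(G)]

/-- The cycle space `Z₁(G) = ker ∂₁`, a subgroup of the chain group `C₁(G) = ℤ^E(G)`. -/
noncomputable def cycleSpace (D : G.Orientation) : Submodule ℤ (E(G) → ℤ) :=
  LinearMap.ker D.incidenceMatrix.mulVecLin

/-- `z ∈ Z₁(G)` is the element corresponding to (one of the two orientations of) the cycle `C`
of `G`: its coefficients are `±1` on the edges of `C` and `0` on all other edges. -/
def IsCycleVector (D : G.Orientation) (C : Graph α β) (z : D.cycleSpace) : Prop :=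
  ∀ e : E(G), ((e : β) ∈ E(C) → z.1 e = 1 ∨ z.1 e = -1) ∧ ((e : β) ∉ E(C) → z.1 e = 0)

/-! ### Unicyclizers, the winding number and the standard harmonic cycle -/

/-- The integer matrix `M` (playing the role of `∂₂`) is a unicyclizer of `G`: `ker M = 0`,
`∂₁ M = 0`, and `ker ∂₁ / im M` has rank one. -/
structure IsUnicyclizer (D : G.Orientation) {r : ℕ} (M : Matrix E(G) (Fin r) ℤ) : Prop where
  ker_eq_bot : LinearMap.ker M.mulVecLin = ⊥
  mul_eq_zero : D.incidenceMatrix * M = 0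
  rank_eq_one : Module.finrank ℤ
    (D.cycleSpace ⧸ (LinearMap.range M.mulVecLin).submoduleOf D.cycleSpace) = 1

namespace IsUnicyclizer

variable {D : G.Orientation} {r : ℕ} {M : Matrix E(G) (Fin r) ℤ}

/-- The columns of a unicyclizer, as elements of the cycle space. -/
def column (h : D.IsUnicyclizer M) (j : Fin r) : D.cycleSpace :=
  ⟨M.col j, by
    ext x
    exact congrFun (congrFun h.mul_eq_zero x) j⟩

/-- The cycle space of a unicyclization with `r` columns has rank `r + 1`; so its ordered bases
are exactly those indexed by `Fin (r + 1)`. -/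
lemma finrank_cycleSpace (h : D.IsUnicyclizer M) :
    Module.finrank ℤ D.cycleSpace = r + 1 := by
  have hle : LinearMap.range M.mulVecLin ≤ D.cycleSpace := by
    rintro _ ⟨c, rfl⟩
    simp [cycleSpace, Matrix.mulVec_mulVec, h.mul_eq_zero]
  have h1 := Submodule.finrank_quotient_add_finrank
    ((LinearMap.range M.mulVecLin).submoduleOf D.cycleSpace)
  have h2 := (Submodule.submoduleOfEquivOfLe hle).finrank_eq
  have h3 := LinearMap.finrank_range_of_inj (LinearMap.ker_eq_bot.1 h.ker_eq_bot)
  rw [h.rank_eq_one, h2, h3, Module.finrank_fin_fun] at h1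
  omega

/-- The winding number `w(z) = det ([z]_b, [M]_b)` relative to the basis `b` of the cycle space:
the determinant of the square matrix whose first column holds the coordinates of `z`, followed
by those of the columns of `M`. -/
noncomputable def windingNumber (h : D.IsUnicyclizer M)
    (b : Module.Basis (Fin (r + 1)) ℤ D.cycleSpace) (z : D.cycleSpace) : ℤ :=
  (b.toMatrix (Fin.cons z h.column : Fin (r + 1) → D.cycleSpace)).det

open Classical in
/-- The standard harmonic cycle `λ = ∑_Y w(z_Y) z_Y`, where `Y` runs over all cycletrees. -/
noncomputable def standardHarmonicCycle (h : D.IsUnicyclizer M)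
    (b : Module.Basis (Fin (r + 1)) ℤ D.cycleSpace) (z : G.Cycletree → D.cycleSpace) :
    D.cycleSpace :=
  letI := Fintype.ofFinite G.Cycletree
  ∑ Y : G.Cycletree, h.windingNumber b (z Y) • z Y

end IsUnicyclizer

end Orientation

end Graph

/-! The winding number is linear in `z`, so it suffices to show that the operator `C ↦ ∑ Y, (C ∘
z_Y) z_Y` on the cycle space is multiplication by `k(G)` (`sum_cycletree_smul`); applying `w` to
this identity gives the theorem.

For a spanning tree `T`, `C` is the sum over the edges `e ∉ T` of `C e * z_Y e` times `z_Y`, where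
`Y = T + e` (`eq_sum_fundamentalCycles`): both sides agree off `T`, and a cycle-space element
supported on an acyclic subgraph is zero. Summing over all `T` gives `k(G) C`. By the exchange `(T,
e) ↔ (T + e, e)`, pairs with `e ∉ T` become pairs `(Y, e)` with `e ∈ C_Y` (`treeEdgeEquiv`), and
summing over `e` for fixed `Y` produces `(C ∘ z_Y) z_Y`. -/

namespace Graph

open Relation

/-! ### Cycles from closed walks -/

section Cycles

variable {α β : Type*} {G H C C' : Graph α β} {e : β} {u v : α}

lemma reflTransGen_adj_symm (h : ReflTransGen G.Adj u v) : ReflTransGen G.Adj v u :=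
  ReflTransGen.stdSymm.symm _ _ h

/-- A walk between the ends of an edge that it does not use closes up to a cycle. -/
lemma exists_isCycle_of_reflTransGen (hH : H ≤ G) (he : e ∉ E(H)) (hl : G.IsLink e u v)
    (hr : ReflTransGen H.Adj v u) :
    ∃ C : Graph α β, C ≤ G ∧ C.IsCycle ∧ e ∈ E(C) := by
  classical
  have : Nonempty β := ⟨e⟩
  -- Passing to a simple graph turns the walk into a path, whose vertices are distinct.
  have hreach : (SimpleGraph.fromRel H.Adj).Reachable v u := by
    clear hl
    induction hr with
    | refl => exact .refl _
    | @tail b c _ hbc ih =>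
      by_cases h : b = c
      · exact h ▸ ih
      · exact ih.trans (SimpleGraph.Adj.reachable ((SimpleGraph.fromRel_adj _ _ _).2 ⟨h, .inl hbc⟩))
  obtain ⟨p, hp⟩ := hreach.exists_isPath
  have hinj := hp.getVert_injOn
  have hadj : ∀ i, i < p.length → ∃ f, H.IsLink f (p.getVert i) (p.getVert (i + 1)) := by
    intro i hi
    rcases ((SimpleGraph.fromRel_adj _ _ _).1 (p.adj_getVert_succ hi)).2 with h | h
    · exact h
    · exact h.symm
  choose! f hf using hadj
  let x : Fin (p.length + 1) → α := fun i => p.getVert i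
  -- The last index carries `e`, which closes the path because indices wrap around; if `u = v`, the
  -- cycle is the loop `e`.
  let ε : Fin (p.length + 1) → β := fun i => if i.1 < p.length then f i else e
  have hx : Function.Injective x := fun i j hij =>
    Fin.ext (hinj (Nat.lt_succ_iff.1 i.2) (Nat.lt_succ_iff.1 j.2) hij)
  have hεf : ∀ i, i.1 < p.length → ε i = f i := fun i hi => if_pos hi
  have hεe : ∀ i, ¬ i.1 < p.length → ε i = e := fun i hi => if_neg hi
  have hfe : ∀ i, i < p.length → f i ≠ e := fun i hi h => he (h ▸ (hf i hi).edge_mem)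
  have hε : Function.Injective ε := by
    intro i j hij
    by_cases hi : i.1 < p.length <;> by_cases hj : j.1 < p.length
    · rw [hεf i hi, hεf j hj] at hij
      have h1 := hf i hi
      rw [hij] at h1
      rcases h1.eq_and_eq_or_eq_and_eq (hf j hj) with ⟨h, -⟩ | ⟨h, h'⟩
      · exact Fin.ext (hinj (Set.mem_ofPred.2 hi.le) (Set.mem_ofPred.2 hj.le) h)
      -- An edge used in opposite directions would force `i = j + 1` and `i + 1 = j`.
      · have a := hinj (Set.mem_ofPred.2 hi.le) (Set.mem_ofPred.2 hj) h
        have b := hinj (Set.mem_ofPred.2 hi) (Set.mem_ofPred.2 hj.le) h'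
        omega
    · rw [hεf i hi, hεe j hj] at hij
      exact absurd hij (hfe _ hi)
    · rw [hεe i hi, hεf j hj] at hij
      exact absurd hij.symm (hfe _ hj)
    · ext
      omega
  have hlink : ∀ i, G.IsLink (ε i) (x i) (x (i + 1)) := by
    intro i
    by_cases hi : i.1 < p.length
    · rw [hεf i hi]
      have : x (i + 1) = p.getVert (i.1 + 1) := by
        simp only [x]
        rw [Fin.val_add_one_of_lt (by rw [Fin.lt_def]; simpa using hi)]
      rw [this]
      exact (hf i hi).mono hH
    · have hi' : i = Fin.last _ := by
        ext
        simp only [Fin.val_last]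
        omega
      subst hi'
      rw [hεe _ hi]
      simpa [x] using hl
  have hmem : e ∈ Set.range ε := ⟨Fin.last _, hεe _ (by simp)⟩
  have hC : ∀ i, ((G.induce (Set.range x)).restrict (Set.range ε)).IsLink (ε i) (x i) (x (i + 1)) :=
    fun i => by
      simp only [restrict_isLink, induce_isLink]
      exact ⟨⟨i, rfl⟩, hlink i, ⟨i, rfl⟩, ⟨i + 1, rfl⟩⟩
  refine ⟨(G.induce (Set.range x)).restrict (Set.range ε),
    restrict_le.trans (induce_le ?_), ⟨_, x, ε, hx, hε, rfl, ?_, hC⟩, ?_⟩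
  · rintro _ ⟨i, rfl⟩
    exact (hlink i).left_mem
  · refine Set.Subset.antisymm (fun _ h => h.2) ?_
    rintro _ ⟨i, rfl⟩
    exact (hC i).edge_mem
  · obtain ⟨i, hi⟩ := hmem
    exact hi ▸ (hC i).edge_mem

lemma IsCycle.vertexSet_eq (hC : C.IsCycle) (hle : C ≤ G) : V(C) = {v | ∃ e ∈ E(C), G.Inc e v} := by
  ext v
  constructor
  · obtain ⟨n, x, e, -, -, hV, -, hl⟩ := hC
    intro hv
    obtain ⟨i, rfl⟩ := hV ▸ hv
    exact ⟨e i, (hl i).edge_mem, ((hl i).mono hle).inc_left⟩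
  · rintro ⟨e, he, hi⟩
    exact ((hle.inc_congr he).2 hi).vertex_mem

lemma IsCycle.eq_of_edgeSet_eq (hC : C.IsCycle) (hC' : C'.IsCycle) (hle : C ≤ G) (hle' : C' ≤ G)
    (h : E(C) = E(C')) : C = C' :=
  (Compatible.of_le_le hle hle').ext
    (by rw [hC.vertexSet_eq hle, hC'.vertexSet_eq hle', h]) h

end Cycles

/-! ### Supports of elements of the cycle space -/

namespace Orientation

variable {α β : Type*} {G H C C' : Graph α β} [Fintype E(G)]

/-- A cycle has zero pairing with every coboundary. -/
lemma sum_mul_head_sub_tail [Finite V(G)] (D : G.Orientation) (z : D.cycleSpace) (f : V(G) → ℤ) :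
    ∑ e, z.1 e * (f (D.head e) - f (D.tail e)) = 0 := by
  classical
  let _ := Fintype.ofFinite V(G)
  have hz : D.incidenceMatrix.mulVec z.1 = 0 := z.2
  have h : f ⬝ᵥ D.incidenceMatrix.mulVec z.1 = 0 := by rw [hz, dotProduct_zero]
  rw [Matrix.dotProduct_mulVec] at h
  rw [← h]
  refine Finset.sum_congr rfl fun e _ => ?_
  rw [mul_comm]
  congr 1
  simp [Matrix.vecMul, dotProduct, incidenceMatrix, mul_sub, Finset.sum_sub_distrib]

/-- An element of the cycle space supported on `H` vanishes at the bridges of `H`. -/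
lemma eq_zero_of_not_reflTransGen [Finite V(G)] (D : G.Orientation) (hH : H ≤ G)
    (z : D.cycleSpace) (hz : ∀ e : E(G), (e : β) ∉ E(H) → z.1 e = 0) (e : E(G))
    (he : ¬ ReflTransGen (H.deleteEdges {(e : β)}).Adj (D.tail e) (D.head e)) : z.1 e = 0 := by
  classical
  -- The test function is the indicator of the component of the tail of `e` in `H - e`. Other edges
  -- of `H` do not leave it, and `z` vanishes outside `H`, so only the term of `e` survives.
  have h := D.sum_mul_head_sub_tail z
    (fun v => if ReflTransGen (H.deleteEdges {(e : β)}).Adj (D.tail e) v then 1 else 0)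
  rw [Finset.sum_eq_single e ?_ (by simp), if_neg he, if_pos .refl] at h
  · simpa using h
  · intro e' _ hne
    by_cases he' : (e' : β) ∈ E(H)
    · have hadj : (H.deleteEdges {(e : β)}).Adj (D.tail e') (D.head e') := by
        refine ⟨e', ?_⟩
        rw [deleteEdges_isLink]
        exact ⟨(hH.isLink_iff he').2 (D.isLink e'), fun h => hne (Subtype.ext h)⟩
      have : ReflTransGen (H.deleteEdges {(e : β)}).Adj (D.tail e) (D.head e') ↔
          ReflTransGen (H.deleteEdges {(e : β)}).Adj (D.tail e) (D.tail e') :=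
        ⟨fun h => h.tail hadj.symm, fun h => h.tail hadj⟩
      simp [this]
    · simp [hz e' he']

/-- An element of the cycle space supported on an acyclic subgraph is zero. -/
lemma eq_zero_of_acyclic [Finite V(G)] (D : G.Orientation) (hH : H ≤ G)
    (hac : ∀ C : Graph α β, C ≤ H → ¬ C.IsCycle)
    (z : D.cycleSpace) (hz : ∀ e : E(G), (e : β) ∉ E(H) → z.1 e = 0) : z = 0 := by
  ext e
  by_cases he : (e : β) ∈ E(H)
  · refine D.eq_zero_of_not_reflTransGen hH z hz e fun hr => ?_
    obtain ⟨C, hC, hcyc, -⟩ := exists_isCycle_of_reflTransGen (e := (e : β)) deleteEdges_le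
      (by simp) ((hH.isLink_iff he).2 (D.isLink e).symm) hr
    exact hac C hC hcyc
  · exact hz e he

/-- Going once around the cycle, with sign `+1` where an edge is traversed from its tail, the
boundaries telescope. This lets non-bridges and uniqueness of cycles be handled by linear algebra.
-/
lemma exists_isCycleVector (D : G.Orientation) (hC : C.IsCycle) (hle : C ≤ G) :
    ∃ z : D.cycleSpace, D.IsCycleVector C z := by
  classical
  obtain ⟨n, x, ε, -, hε, -, hE, hl⟩ := hC
  have hG : ∀ i, ε i ∈ E(G) := fun i => ((hl i).mono hle).edge_mem
  let s : Fin (n + 1) → ℤ := fun i => if (D.tail ⟨ε i, hG i⟩ : α) = x i then 1 else -1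
  let z : E(G) → ℤ := ∑ i, s i • Pi.single ⟨ε i, hG i⟩ 1
  have hs : ∀ i, s i = 1 ∨ s i = -1 := fun i => by
    simp only [s]
    split_ifs <;> simp
  have hsum : ∀ (i) (v : V(G)), s i * D.incidenceMatrix v ⟨ε i, hG i⟩ =
      (if (v : α) = x (i + 1) then 1 else 0) - (if (v : α) = x i then 1 else 0) := by
    intro i v
    simp only [incidenceMatrix, Matrix.of_apply, Subtype.ext_iff, s]
    rcases ((hl i).mono hle).eq_and_eq_or_eq_and_eq (D.isLink ⟨ε i, hG i⟩) with ⟨h, h'⟩ | ⟨h, h'⟩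
    · simp [h, h']
    · rw [h, h']
      split_ifs <;> simp_all
  have hz : z ∈ D.cycleSpace := by
    rw [cycleSpace, LinearMap.mem_ker, map_sum]
    ext v
    simp only [map_smul, Matrix.mulVecLin_apply, Matrix.mulVec_single_one, Finset.sum_apply,
      Pi.smul_apply, Matrix.col_apply, smul_eq_mul, hsum, Finset.sum_sub_distrib, Pi.zero_apply]
    rw [sub_eq_zero]
    exact Equiv.sum_comp (Equiv.addRight (1 : Fin (n + 1)))
      (fun i => if (v : α) = x i then (1 : ℤ) else 0)
  refine ⟨⟨z, hz⟩, fun e => ⟨fun he => ?_, fun he => ?_⟩⟩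
  · rw [hE] at he
    obtain ⟨i, hi⟩ := he
    change z e = 1 ∨ z e = -1
    have : z e = s i := by
      simp only [z, Finset.sum_apply, Pi.smul_apply, Pi.single_apply, Subtype.ext_iff, ← hi,
        hε.eq_iff]
      simp
    exact this.symm ▸ hs i
  · simp only [z, Finset.sum_apply, Pi.smul_apply, Pi.single_apply, Subtype.ext_iff]
    refine Finset.sum_eq_zero fun i _ => ?_
    rw [if_neg (fun h => he (by rw [hE, h]; exact ⟨i, rfl⟩)), smul_zero]

lemma IsCycleVector.mem_iff {D : G.Orientation} {z : D.cycleSpace} (hz : D.IsCycleVector C z)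
    (e : E(G)) : (e : β) ∈ E(C) ↔ z.1 e ≠ 0 := by
  constructor
  · intro h
    rcases (hz e).1 h with h | h <;> simp [h]
  · intro h
    by_contra h'
    exact h ((hz e).2 h')

lemma IsCycleVector.mul_self {D : G.Orientation} {z : D.cycleSpace} (hz : D.IsCycleVector C z)
    {e : E(G)} (he : (e : β) ∈ E(C)) : z.1 e * z.1 e = 1 := by
  rcases (hz e).1 he with h | h <;> simp [h]

/-- Two cycles sharing an edge whose removal leaves an acyclic graph coincide. -/
lemma isCycle_unique [Finite V(G)] (D : G.Orientation) (hH : H ≤ G)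
    (hac : ∀ C : Graph α β, C ≤ H → ¬ C.IsCycle) (e : E(G))
    (hC : C.IsCycle) (hC' : C'.IsCycle) (hle : C ≤ G) (hle' : C' ≤ G)
    (he : (e : β) ∈ E(C)) (he' : (e : β) ∈ E(C'))
    (hs : E(C) ⊆ insert (e : β) E(H)) (hs' : E(C') ⊆ insert (e : β) E(H)) : C = C' := by
  obtain ⟨z, hz⟩ := D.exists_isCycleVector hC hle
  obtain ⟨z', hz'⟩ := D.exists_isCycleVector hC' hle'
  -- The coefficients cancel at `e`, leaving an element supported on the acyclic `H`.
  have key : z'.1 e • z - z.1 e • z' = 0 := by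
    refine D.eq_zero_of_acyclic hH hac _ fun f hf => ?_
    by_cases hfe : f = e
    · subst hfe
      simp [mul_comm]
    · have hne : (f : β) ≠ e := fun h => hfe (Subtype.ext h)
      have h1 : z.1 f = 0 := (hz f).2 fun h => (hs h).elim hne hf
      have h2 : z'.1 f = 0 := (hz' f).2 fun h => (hs' h).elim hne hf
      simp [h1, h2]
  refine hC.eq_of_edgeSet_eq hC' hle hle' (Set.ext fun f => ?_)
  have aux : ∀ f : E(G), (f : β) ∈ E(C) ↔ (f : β) ∈ E(C') := by
    intro f
    have hf : z'.1 e * z.1 f = z.1 e * z'.1 f :=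
      sub_eq_zero.1 (congrFun (congrArg Subtype.val key) f)
    rw [hz.mem_iff, hz'.mem_iff, ← mul_ne_zero_iff_left ((hz'.mem_iff e).1 he'), hf]
    simp [(hz.mem_iff e).1 he]
  exact ⟨fun h => (aux ⟨f, hle.edgeSet_mono h⟩).1 h, fun h => (aux ⟨f, hle'.edgeSet_mono h⟩).2 h⟩

end Orientation

/-! ### Exchange between spanning trees and cycletrees -/

section Exchange

variable {α β : Type*} {G H T C : Graph α β} {e : β}

lemma Cycletree.cycle_le (Y : G.Cycletree) : Y.cycle ≤ Y.1 :=
  Y.2.existsUnique_cycle.choose_spec.1.1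

lemma Cycletree.isCycle_cycle (Y : G.Cycletree) : Y.cycle.IsCycle :=
  Y.2.existsUnique_cycle.choose_spec.1.2

lemma Cycletree.eq_cycle (Y : G.Cycletree) (hle : C ≤ Y.1) (hC : C.IsCycle) : C = Y.cycle :=
  Y.2.existsUnique_cycle.choose_spec.2 C ⟨hle, hC⟩

lemma Cycletree.cycle_le_graph (Y : G.Cycletree) : Y.cycle ≤ G :=
  Y.cycle_le.trans Y.2.spanning.le

/-- A cycle avoiding `e` would already lie in the tree. -/
lemma mem_edgeSet_of_isCycle_le_restrict (hT : G.IsSpanningTree T)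
    (hle : C ≤ G.restrict (insert e E(T))) (hC : C.IsCycle) : e ∈ E(C) := by
  by_contra he
  refine hT.acyclic C (((Compatible.of_le_le (hle.trans restrict_le) hT.spanning.le).le_iff).2
    ⟨?_, fun f hf => ?_⟩) hC
  · rw [hT.spanning.vertexSet_eq]
    exact (hle.trans restrict_le).vertexSet_mono
  · rcases (hle.edgeSet_mono hf).2 with h | h
    · exact absurd (h ▸ hf) he
    · exact h

/-- Adding an edge to a spanning tree gives a cycletree. -/
lemma IsSpanningTree.isCycletree_restrict_insert [Finite V(G)] [Fintype E(G)] (D : G.Orientation)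
    (hT : G.IsSpanningTree T) (heG : e ∈ E(G)) (he : e ∉ E(T)) :
    G.IsCycletree (G.restrict (insert e E(T))) := by
  have hTY : T ≤ G.restrict (insert e E(T)) :=
    ((Compatible.of_le_le hT.spanning.le restrict_le).le_iff).2
      ⟨hT.spanning.vertexSet_eq.le, fun f hf => ⟨hT.spanning.le.edgeSet_mono hf, .inr hf⟩⟩
  obtain ⟨x, y, hl⟩ := exists_isLink_of_mem_edgeSet heG
  have hV : V(T) = V(G) := hT.spanning.vertexSet_eq
  refine ⟨⟨restrict_le, rfl⟩, ⟨hV ▸ hT.connected.1, fun x hx y hy => ?_⟩, ?_⟩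
  · exact ReflTransGen.lift id (fun _ _ h => Adj.mono hTY h) _ _ (hT.connected.2 x (hV ▸ hx) y (hV ▸ hy))
  · obtain ⟨C, hC, hcyc, heC⟩ := exists_isCycle_of_reflTransGen (e := e) (u := x) (v := y) hTY he
      (by rw [restrict_isLink]; exact ⟨.inl rfl, hl⟩)
      (hT.connected.2 y (hV ▸ hl.right_mem) x (hV ▸ hl.left_mem))
    refine ⟨C, ⟨hC, hcyc⟩, fun C' ⟨hC', hcyc'⟩ => ?_⟩
    exact D.isCycle_unique hT.spanning.le hT.acyclic ⟨e, heG⟩ hcyc' hcyc (hC'.trans restrict_le)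
      (hC.trans restrict_le) (mem_edgeSet_of_isCycle_le_restrict hT hC' hcyc') heC
      (fun f hf => (hC'.edgeSet_mono hf).2) (fun f hf => (hC.edgeSet_mono hf).2)

/-- Removing an edge of its cycle from a cycletree gives a spanning tree. -/
lemma Cycletree.isSpanningTree_deleteEdges [Finite V(G)] [Fintype E(G)] (D : G.Orientation)
    (Y : G.Cycletree) (he : e ∈ E(Y.cycle)) : G.IsSpanningTree (Y.1.deleteEdges {e}) := by
  have hV : V(Y.1) = V(G) := Y.2.spanning.vertexSet_eq
  refine ⟨⟨deleteEdges_le.trans Y.2.spanning.le, hV⟩, ⟨Y.2.connected.1, ?_⟩, ?_⟩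
  · obtain ⟨z, hz⟩ := D.exists_isCycleVector Y.isCycle_cycle Y.cycle_le_graph
    have heG : e ∈ E(G) := Y.cycle_le_graph.edgeSet_mono he
    -- The cycle vector is nonzero at `e`, so `e` is not a bridge of `Y`; walks through `e` can be
    -- rerouted.
    have hr : ReflTransGen (Y.1.deleteEdges {e}).Adj (D.tail ⟨e, heG⟩) (D.head ⟨e, heG⟩) := by
      by_contra hr
      exact (hz.mem_iff ⟨e, heG⟩).1 he (D.eq_zero_of_not_reflTransGen Y.2.spanning.le z
        (fun f hf => (hz f).2 fun h => hf (Y.cycle_le.edgeSet_mono h)) ⟨e, heG⟩ hr)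
    intro x hx y hy
    have hxy := Y.2.connected.2 x hx y hy
    clear hy
    induction hxy with
    | refl => exact .refl
    | @tail b c _ hbc ih =>
      refine ih.trans ?_
      obtain ⟨f, hf⟩ := hbc
      by_cases hfe : f = e
      · subst hfe
        rcases (hf.mono Y.2.spanning.le).eq_and_eq_or_eq_and_eq (D.isLink ⟨f, heG⟩) with
          ⟨rfl, rfl⟩ | ⟨rfl, rfl⟩
        · exact hr
        · exact reflTransGen_adj_symm hr
      · refine .single ⟨f, ?_⟩
        rw [deleteEdges_isLink]
        exact ⟨hf, hfe⟩
  · intro C hC hcyc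
    have h := Y.eq_cycle (hC.trans deleteEdges_le) hcyc
    subst h
    exact (hC.edgeSet_mono he).2 rfl

/-- Pairs of a spanning tree and an edge outside it correspond to pairs of a cycletree and an edge
of its cycle. -/
noncomputable def treeEdgeEquiv [Finite V(G)] [Fintype E(G)] (D : G.Orientation) :
    {p : {T : Graph α β // G.IsSpanningTree T} × E(G) // (p.2 : β) ∉ E(p.1.1)} ≃
      {p : G.Cycletree × E(G) // (p.2 : β) ∈ E(p.1.cycle)} where
  toFun p := ⟨(⟨_, p.1.1.2.isCycletree_restrict_insert D p.1.2.2 p.2⟩, p.1.2),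
    mem_edgeSet_of_isCycle_le_restrict p.1.1.2 (Cycletree.cycle_le _) (Cycletree.isCycle_cycle _)⟩
  invFun p := ⟨(⟨_, p.1.1.isSpanningTree_deleteEdges D p.2⟩, p.1.2), by simp⟩
  left_inv := by
    rintro ⟨⟨⟨T, hT⟩, e, heG⟩, he⟩
    refine Subtype.ext (Prod.ext (Subtype.ext ?_) rfl)
    refine (Compatible.of_le_le (deleteEdges_le.trans restrict_le) hT.spanning.le).ext
      hT.spanning.vertexSet_eq.symm ?_
    have := hT.spanning.le.edgeSet_mono
    ext f
    simp only [edgeSet_deleteEdges, edgeSet_restrict, Set.mem_sdiff, Set.mem_inter_iff,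
      Set.mem_insert_iff, Set.mem_singleton_iff]
    constructor
    · tauto
    · intro hf
      exact ⟨⟨this hf, .inr hf⟩, fun h => he (h ▸ hf)⟩
  right_inv := by
    rintro ⟨⟨Y, e, heG⟩, he⟩
    refine Subtype.ext (Prod.ext (Subtype.ext ?_) rfl)
    refine (Compatible.of_le_le restrict_le Y.2.spanning.le).ext Y.2.spanning.vertexSet_eq.symm ?_
    have := Y.2.spanning.le.edgeSet_mono
    have he' := Y.cycle_le.edgeSet_mono he
    ext f
    simp only [edgeSet_deleteEdges, edgeSet_restrict, Set.mem_sdiff, Set.mem_inter_iff,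
      Set.mem_insert_iff, Set.mem_singleton_iff]
    constructor
    · rintro ⟨-, rfl | h⟩
      · exact he'
      · exact h.1
    · intro hf
      exact ⟨this hf, by tauto⟩

lemma treeEdgeEquiv_snd [Finite V(G)] [Fintype E(G)] (D : G.Orientation)
    (p : {p : {T : Graph α β // G.IsSpanningTree T} × E(G) // (p.2 : β) ∉ E(p.1.1)}) :
    (treeEdgeEquiv D p).1.2 = p.1.2 := rfl

lemma edgeSet_cycle_treeEdgeEquiv_subset [Finite V(G)] [Fintype E(G)] (D : G.Orientation)
    (p : {p : {T : Graph α β // G.IsSpanningTree T} × E(G) // (p.2 : β) ∉ E(p.1.1)}) :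
    E((treeEdgeEquiv D p).1.1.cycle) ⊆ insert (p.1.2 : β) E(p.1.1.1) :=
  fun _ hf => ((treeEdgeEquiv D p).1.1.cycle_le.edgeSet_mono hf).2

instance [Finite E(G)] : Finite {T : Graph α β // G.IsSpanningTree T} :=
  (G.finite_spanningSubgraphs.subset fun _ h => IsSpanningTree.spanning h).to_subtype

end Exchange

/-! ### Fundamental cycle expansions and their sum over all trees -/

namespace Orientation

variable {α β : Type*} {G : Graph α β} [Fintype E(G)]

open Classical in
/-- The expansion of an element of the cycle space in the fundamental cycles of a spanning tree. -/
lemma eq_sum_fundamentalCycles [Finite V(G)] (D : G.Orientation) (z : G.Cycletree → D.cycleSpace)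
    (hz : ∀ Y : G.Cycletree, D.IsCycleVector Y.cycle (z Y)) (C : D.cycleSpace)
    (T : {T : Graph α β // G.IsSpanningTree T}) :
    ∑ e : {e : E(G) // (e : β) ∉ E(T.1)},
      (C.1 e.1 * (z (treeEdgeEquiv D ⟨(T, e.1), e.2⟩).1.1).1 e.1) •
        z (treeEdgeEquiv D ⟨(T, e.1), e.2⟩).1.1 = C := by
  refine sub_eq_zero.1 (D.eq_zero_of_acyclic T.2.spanning.le T.2.acyclic _ fun f hf => ?_)
  rw [Submodule.coe_sub, Pi.sub_apply, sub_eq_zero, Submodule.coe_sum, Finset.sum_apply,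
    Finset.sum_eq_single ⟨f, hf⟩ ?_ (by simp)]
  -- The coefficient of `z_Y` at `f` squares to `1`, so the choice of orientation of each cycle is
  -- immaterial.
  · have h := (hz _).mul_self (treeEdgeEquiv D ⟨(T, f), hf⟩).2
    rw [treeEdgeEquiv_snd] at h
    simp only [Submodule.coe_smul, Pi.smul_apply, smul_eq_mul]
    rw [mul_assoc, h, mul_one]
  · intro e _ hne
    have h0 : (z (treeEdgeEquiv D ⟨(T, e.1), e.2⟩).1.1).1 f = 0 := by
      refine ((hz _) f).2 fun h => ?_
      rcases edgeSet_cycle_treeEdgeEquiv_subset D _ h with h | h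
      · exact hne (Subtype.ext (Subtype.ext h.symm))
      · exact hf h
    simp [h0]

open Classical in
/-- The sum of the rank-one operators of the cycles of all cycletrees acts on the cycle space as
multiplication by the tree-number. -/
lemma sum_cycletree_smul [Finite V(G)] [Fintype G.Cycletree] (D : G.Orientation)
    (z : G.Cycletree → D.cycleSpace)
    (hz : ∀ Y : G.Cycletree, D.IsCycleVector Y.cycle (z Y)) (C : D.cycleSpace) :
    ∑ Y : G.Cycletree, (C.1 ⬝ᵥ (z Y).1) • z Y = (G.treeNumber : ℤ) • C := by
  let _ := Fintype.ofFinite {T : Graph α β // G.IsSpanningTree T}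
  have hdot : ∀ Y : G.Cycletree, (C.1 ⬝ᵥ (z Y).1) • z Y =
      ∑ e : {e : E(G) // (e : β) ∈ E(Y.cycle)}, (C.1 e.1 * (z Y).1 e.1) • z Y := by
    intro Y
    rw [← Finset.sum_smul]
    congr 1
    rw [← Finset.sum_subtype (Finset.univ.filter fun e : E(G) => (e : β) ∈ E(Y.cycle)) (by simp)
      fun e => C.1 e * (z Y).1 e]
    refine (Finset.sum_filter_of_ne fun e _ hne => ?_).symm
    exact ((hz Y).mem_iff e).2 (right_ne_zero_of_mul hne)
  have htree : (G.treeNumber : ℤ) • C =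
      ∑ _T : {T : Graph α β // G.IsSpanningTree T}, C := by
    simp [treeNumber, Nat.card_eq_fintype_card]
  -- Both sides become sums over pairs, `(Y, e)` and `(T, e)`, matched by `treeEdgeEquiv`.
  rw [htree, Finset.sum_congr rfl fun Y _ => hdot Y,
    ← Finset.sum_congr rfl fun T _ => D.eq_sum_fundamentalCycles z hz C T,
    ← Fintype.sum_sigma', ← Fintype.sum_sigma',
    ← Equiv.sum_comp (Equiv.subtypeProdEquivSigmaSubtype
      fun (Y : G.Cycletree) (e : E(G)) => (e : β) ∈ E(Y.cycle)),
    ← Equiv.sum_comp (Equiv.subtypeProdEquivSigmaSubtype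
      fun (T : {T : Graph α β // G.IsSpanningTree T}) (e : E(G)) => (e : β) ∉ E(T.1)),
    ← Equiv.sum_comp (treeEdgeEquiv D)]
  rfl

/-- The winding number as a linear functional on the cycle space. -/
noncomputable def IsUnicyclizer.windingHom {D : G.Orientation} {r : ℕ}
    {M : Matrix E(G) (Fin r) ℤ} (h : D.IsUnicyclizer M)
    (b : Module.Basis (Fin (r + 1)) ℤ D.cycleSpace) : D.cycleSpace →ₗ[ℤ] ℤ where
  toFun := h.windingNumber b
  map_add' := b.det.toMultilinearMap.cons_add h.column
  map_smul' := b.det.toMultilinearMap.cons_smul h.column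

end Orientation

end Graph

theorem theoremA {α β : Type*} (G : Graph α β) [Finite V(G)] [Fintype E(G)]
    (hG : G.IsConnected) (D : G.Orientation)
    {r : ℕ} (M : Matrix E(G) (Fin r) ℤ) (hM : D.IsUnicyclizer M)
    (b : Module.Basis (Fin (r + 1)) ℤ D.cycleSpace)
    (z : G.Cycletree → D.cycleSpace)
    (hz : ∀ Y : G.Cycletree, D.IsCycleVector Y.cycle (z Y))
    (C : D.cycleSpace) :
    C.1 ⬝ᵥ (hM.standardHarmonicCycle b z).1 = hM.windingNumber b C * (G.treeNumber : ℤ) := by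
  classical
  let _ := Fintype.ofFinite G.Cycletree
  have h := congrArg (hM.windingHom b) (D.sum_cycletree_smul z hz C)
  simp only [map_sum, map_smul, smul_eq_mul] at h
  calc C.1 ⬝ᵥ (hM.standardHarmonicCycle b z).1
      = ∑ Y : G.Cycletree, (C.1 ⬝ᵥ (z Y).1) * hM.windingNumber b (z Y) := by
        simp only [Graph.Orientation.IsUnicyclizer.standardHarmonicCycle, Submodule.coe_sum,
          Submodule.coe_smul, dotProduct_sum, dotProduct_smul, smul_eq_mul]
        exact Finset.sum_congr rfl fun Y _ => mul_comm _ _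
    _ = (G.treeNumber : ℤ) * hM.windingNumber b C := h
    _ = _ := mul_comm _ _
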